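/- Let $\gamma\sim\mathcal N(0,1)$. For a measurable function $\sigma:\mathbb R\to\mathbb R$, $0<a\le b<\infty$ and $q>0$, define \[ s_\sigma(a,b):=\sup_{s\in[a,b]}\frac{\mathbb E[\sigma(s\gamma)^2]}{(\mathbb E[\sigma(s\gamma)])^2},\qquad \kappa_{\sigma,q}(a,b):=\inf_{s\in[a,b]}\frac{|\mathbb E[\sigma(s\gamma)]|}{s^q}. \] For a nonzero real matrix $A$ let $\mathrm{st}(A):=\|A\|_F^2/\|A\|_{\mathrm{op}}^2$ be its stable rank. For every $p\ge 1$ there is a constant $c=c(p)>0$, depending only on $p$, such that the following holds. Let $m,d,n\ge 1$, let $X=[x_1,\dots,x_n]\in\mathbb R^{d\times n}$ be a fixed matrix with nonzero columns, and let $W\in\mathbb R^{m\times d}$ have i.i.d. $\mathcal N(0,\tfrac1d)$ entries. Let $\sigma:\mathbb R\to\mathbb R$ be measurable with $\sigma(0)=0$ and $|\sigma(t)|\le L_\sigma|t|^p$ for all $t\in\mathbb R$, where $L_\sigma<\infty$, and let $A=\sigma(WX)\in\mathbb R^{m\times n}$, with $\sigma$ applied entrywise. Set \[ a:=\frac1{\sqrt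 d}\min_{1\le t\le n}\|x_t\|_2,\qquad b:=\frac1{\sqrt d}\max_{1\le t\le n}\|x_t\|_2, \] let $q>0$ satisfy $\kappa_{\sigma,q}(a,b)>0$, and put \[ r:=\frac{L_\sigma}{\kappa_{\sigma,q}(a,b)}\cdot\sup_{s\in[a,b]}s^{p-q}. \] Then for all $0<\varepsilon_1\le 1$ and $0<\varepsilon_2<1$, with probability at least \[ 1-2\exp\Big(-c\min\big\{m\varepsilon_2^2r^{-2},\ m^{\min\{1,2/p\}}\varepsilon_2^{2/p}r^{-2/p}\big\}\Big) -2\exp\Big(-c\min\big\{m\varepsilon_1^2r^{-4},\ m^{\min\{1,1/p\}}\varepsilon_1^{1/p}r^{-2/p}\big\}\Big), \] the matrix $A$ is nonzero and \[ \mathrm{st}(A)\le\frac{1+\varepsilon_1}{(1-\varepsilon_2)^2}\,s_\sigma(a,b). \] Moreover, for the ReLU activation $\sigma(t)=\max\{t,0\}$ one has $s_\sigma(a,b)=\pi$ for all $0<a\le b<\infty$. -/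

import Mathlib

open MeasureTheory ProbabilityTheory

noncomputable section

/-- The Frobenius norm `‖A‖_F` of a real matrix. -/
def frobNorm {m n : ℕ} (A : Matrix (Fin m) (Fin n) ℝ) : ℝ :=
  letI := Matrix.frobeniusNormedAddCommGroup (m := Fin m) (n := Fin n) (α := ℝ)
  ‖A‖

/-- The operator norm `‖A‖_op` of a real matrix with respect to the Euclidean norms. -/
def opNorm {m n : ℕ} (A : Matrix (Fin m) (Fin n) ℝ) : ℝ :=
  letI := Matrix.instL2OpNormedAddCommGroup (m := Fin m) (n := Fin n) (𝕜 := ℝ)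
  ‖A‖

/-- The stable rank `st(A) = ‖A‖_F² / ‖A‖_op²` (meaningful for `A ≠ 0`). -/
def stableRank {m n : ℕ} (A : Matrix (Fin m) (Fin n) ℝ) : ℝ :=
  frobNorm A ^ 2 / opNorm A ^ 2

/-- The post-activation matrix `σ(WX)`, with `σ` applied entrywise. -/
def postActivation {m d n : ℕ} (σ : ℝ → ℝ) (W : Matrix (Fin m) (Fin d) ℝ)
    (X : Matrix (Fin d) (Fin n) ℝ) : Matrix (Fin m) (Fin n) ℝ :=
  (W * X).map σ

/-- The Euclidean norm of the `t`-th column of `X`. -/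
def colNorm {d n : ℕ} (X : Matrix (Fin d) (Fin n) ℝ) (t : Fin n) : ℝ :=
  ‖WithLp.toLp 2 (X.col t)‖

/-- `a = d^{-1/2} min_t ‖x_t‖₂`. -/
def minScale {d n : ℕ} (X : Matrix (Fin d) (Fin n) ℝ) : ℝ :=
  1 / √(d : ℝ) * ⨅ t : Fin n, colNorm X t

/-- `b = d^{-1/2} max_t ‖x_t‖₂`. -/
def maxScale {d n : ℕ} (X : Matrix (Fin d) (Fin n) ℝ) : ℝ :=
  1 / √(d : ℝ) * ⨆ t : Fin n, colNorm X t

/-- `E[f(γ)]` for a standard Gaussian `γ`. -/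
def gaussianExp (f : ℝ → ℝ) : ℝ := ∫ x, f x ∂(gaussianReal 0 1)

/-- `s_σ(a,b) = sup_{s ∈ [a,b]} E[σ(sγ)²] / (E[σ(sγ)])²`. -/
def gaussianRatio (σ : ℝ → ℝ) (a b : ℝ) : ℝ :=
  ⨆ s : Set.Icc a b,
    gaussianExp (fun x => σ ((s : ℝ) * x) ^ 2) / gaussianExp (fun x => σ ((s : ℝ) * x)) ^ 2

/-- `κ_{σ,q}(a,b) = inf_{s ∈ [a,b]} |E[σ(sγ)]| / s^q`. -/
def gaussianKappa (σ : ℝ → ℝ) (q a b : ℝ) : ℝ :=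
  ⨅ s : Set.Icc a b, |gaussianExp (fun x => σ ((s : ℝ) * x))| / (s : ℝ) ^ q

/-- `r_{p,q} = (L / κ_{σ,q}(a,b)) · sup_{s ∈ [a,b]} s^{p-q}`. -/
def scaleRatio (σ : ℝ → ℝ) (L p q a b : ℝ) : ℝ :=
  L / gaussianKappa σ q a b * ⨆ s : Set.Icc a b, (s : ℝ) ^ (p - q)

/-- `W` is a random matrix on `(Ω, P)` with i.i.d. entries of law `N(0, 1/d)`. -/
structure IsGaussianWeight {Ω : Type*} [MeasurableSpace Ω] {m d : ℕ}
    (W : Ω → Matrix (Fin m) (Fin d) ℝ) (P : Measure Ω) : Prop where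
  indep : iIndepFun (fun (ij : Fin m × Fin d) (ω : Ω) => W ω ij.1 ij.2) P
  law : ∀ i j, HasLaw (fun ω => W ω i j) (gaussianReal 0 (1 / (d : NNReal))) P

/-- The ReLU activation `t ↦ max(t, 0)`. -/
def relu (t : ℝ) : ℝ := max t 0

end

/-! Write `s t` for the scaled norm of column `t`, `μ t = E σ(s t γ)` and `e t = E σ(s t γ)²`.
Testing `A` against the all-ones vector on the left and `μ` on the right gives `(1ᵀ A μ)² ≤ m
‖A‖_op² ‖μ‖²`. Now `1ᵀ A μ` has mean `m ‖μ‖²` and `‖A‖_F²` has mean `m ∑ e t`. If the first is at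
least `1 - ε₂` times its mean and the second at most `1 + ε₁` times its mean, then `st(A) ≤ (1 + ε₁)
/ (1 - ε₂)² · (∑ e t) / ∑ μ t ^ 2`, and this ratio of sums is at most the largest ratio `e t / μ t ^
2`, hence at most `s_σ(a,b)` (`stableRank_le_of_bounds`).

Both quantities are sums over the independent rows of `W`. After normalisation each summand has mean
one and is dominated by `R` times a weighted average of powers `|γ_t|^p` (respectively `|γ_t|^(2p)`)
of standard Gaussians, with `R = r` (respectively `r²`). Within a row the `γ_t` are dependent, so
the moment bound `exists_exp_moment_weighted_abs_rpow` must not see their joint law; it comes from a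
Jensen-type inequality. Such averages have stretched-exponential tails of exponent `min 1 (2 / p)`,
and a truncated Chernoff argument (`exists_stretched_exponential_tail`) yields the two-regime bound.
-/

/-! ### Scalar inequalities for exponentials. -/

/-- A second-order upper bound for the exponential, valid on the whole line. -/
lemma exp_le_one_add_add_sq_mul_exp (u : ℝ) :
    Real.exp u ≤ 1 + u + u ^ 2 * Real.exp (max u 0) := by
  rcases le_total 0 u with h | h
  · rw [max_eq_left h]
    have h1 : (1 - u) * Real.exp u ≤ 1 := by
      have := Real.add_one_le_exp (-u)
      calc (1 - u) * Real.exp u ≤ Real.exp (-u) * Real.exp u := by gcongr; linarith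
        _ = 1 := by rw [← Real.exp_add]; simp
    -- Apply `exp u ≤ 1 + u * exp u` twice.
    nlinarith
  · rw [max_eq_right h, Real.exp_zero, mul_one]
    have h1 : (1 - u) * Real.exp u ≤ 1 := by
      have := Real.add_one_le_exp (-u)
      calc (1 - u) * Real.exp u ≤ Real.exp (-u) * Real.exp u := by gcongr; linarith
        _ = 1 := by rw [← Real.exp_add]; simp
    have h2 : 0 ≤ -u ^ 3 := by
      have : 0 ≤ (-u) ^ 3 := pow_nonneg (by linarith) 3
      nlinarith
    -- Here `exp u ≤ 1 / (1 - u)`, while `(1 + u + u²)(1 - u) = 1 - u³ ≥ 1`.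
    by_contra! h3
    nlinarith

/-- Squares are dominated by stretched exponentials. -/
lemma sq_le_mul_exp_rpow {α θ x : ℝ} (hα : 0 < α) (hθ : 0 < θ) (hx : 0 ≤ x) :
    x ^ 2 ≤ (4 / (α * θ)) ^ (2 / α) * Real.exp (θ / 2 * x ^ α) := by
  have hu : 0 ≤ x ^ α := by positivity
  -- The rate `α * θ / 4` becomes `θ / 2` after raising to the power `2 / α`.
  have h1 : x ^ α ≤ 4 / (α * θ) * Real.exp (α * θ / 4 * x ^ α) := by
    have := Real.add_one_le_exp (α * θ / 4 * x ^ α)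
    calc x ^ α = 4 / (α * θ) * (α * θ / 4 * x ^ α) := by field_simp
      _ ≤ _ := by gcongr; linarith
  have h2 := Real.rpow_le_rpow hu h1 (by positivity : 0 ≤ 2 / α)
  rw [← Real.rpow_mul hx, Real.mul_rpow (by positivity) (by positivity), ← Real.exp_mul,
    mul_div_cancel₀ _ hα.ne'] at h2
  rw [Real.rpow_two] at h2
  convert h2 using 3
  field_simp
  ring

/-- Replace the prefactor of an exponential tail bound for a probability by `2`. -/
lemma exists_prefactor_two {C c : ℝ} (hC : 1 ≤ C) (hc : 0 < c) :
    ∃ c' : ℝ, 0 < c' ∧ ∀ P U : ℝ, P ≤ 1 → P ≤ C * Real.exp (-(c * U)) →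
      P ≤ 2 * Real.exp (-(c' * U)) := by
  have hl2 : 0 < Real.log 2 := Real.log_pos (by norm_num)
  have hlC : 0 ≤ Real.log C := Real.log_nonneg hC
  refine ⟨c * Real.log 2 / (Real.log C + Real.log 2), by positivity, fun P U hP hPU => ?_⟩
  set c' := c * Real.log 2 / (Real.log C + Real.log 2) with hc'
  have key : (2 : ℝ) * Real.exp (-(c' * U)) = Real.exp (Real.log 2 - c' * U) := by
    rw [sub_eq_add_neg, Real.exp_add, Real.exp_log (by norm_num)]
  have keyC : C * Real.exp (-(c * U)) = Real.exp (Real.log C - c * U) := by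
    rw [sub_eq_add_neg, Real.exp_add, Real.exp_log (by linarith)]
  have hc2 : c' * (Real.log C + Real.log 2) = c * Real.log 2 := by
    rw [hc']; field_simp
  -- While `c' * U ≤ log 2` the claimed bound is at least `1`. The constant `c'` is chosen so that
  -- beyond this threshold `c * U ≥ log C + log 2`.
  rcases le_total (c' * U) (Real.log 2) with h | h
  · rw [key]
    exact hP.trans (Real.one_le_exp (by linarith))
  · refine hPU.trans ?_
    rw [key, keyC]
    apply Real.exp_le_exp.mpr
    have hU : Real.log C + Real.log 2 ≤ c * U := by
      have h3 : c * Real.log 2 ≤ c * (c' * U) := by gcongr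
      rw [← hc2] at h3
      have hc'0 : 0 < c' := by positivity
      have : c' * (Real.log C + Real.log 2) ≤ c' * (c * U) := by linarith
      exact le_of_mul_le_mul_left this hc'0
    have h4 : c' * U * (Real.log C + Real.log 2) = c * U * Real.log 2 := by
      linear_combination U * hc2
    have h5 : 0 ≤ (c * U - (Real.log C + Real.log 2)) * Real.log C := by
      apply mul_nonneg <;> linarith
    have h6 : (c' * U) * (Real.log C + Real.log 2) ≤
        (Real.log 2 - Real.log C + c * U) * (Real.log C + Real.log 2) := by nlinarith
    have := le_of_mul_le_mul_right h6 (by positivity)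
    linarith

/-- Pointwise bound behind the Chernoff estimate for a truncated stretched-exponential variable. -/
lemma exp_mul_min_le {α θ t l z : ℝ} (hα : 0 < α) (hα1 : α ≤ 1) (hθ : 0 < θ) (ht : 0 < t)
    (hl : 0 ≤ l) (hlt : l ≤ θ / 2 * t ^ (α - 1)) :
    Real.exp (l * min z t) ≤
      1 + l * z + l ^ 2 * ((4 / (α * θ)) ^ (2 / α) * Real.exp (θ * |z| ^ α)) := by
  set y := min z t with hy
  have hyz : y ≤ z := min_le_left _ _
  have hyt : y ≤ t := min_le_right _ _
  have hsq : y ^ 2 ≤ |z| ^ 2 := by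
    rw [sq_abs]
    rcases le_total z t with h | h
    · rw [hy, min_eq_left h]
    · rw [hy, min_eq_right h]; gcongr
  have hexp : max (l * y) 0 ≤ θ / 2 * |z| ^ α := by
    refine max_le ?_ (by positivity)
    rcases le_or_gt y 0 with h | h
    · exact (mul_nonpos_of_nonneg_of_nonpos hl h).trans (by positivity)
    · have h1 : t ^ (α - 1) ≤ y ^ (α - 1) :=
        Real.rpow_le_rpow_of_nonpos h hyt (by linarith)
      calc l * y ≤ θ / 2 * t ^ (α - 1) * y := by gcongr
        _ ≤ θ / 2 * y ^ (α - 1) * y := by gcongr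
        _ = θ / 2 * y ^ α := by
          rw [mul_assoc, ← Real.rpow_add_one h.ne', sub_add_cancel]
        _ ≤ θ / 2 * |z| ^ α := by
          gcongr
          exact hyz.trans (le_abs_self z)
  have hfin : y ^ 2 * Real.exp (max (l * y) 0) ≤
      (4 / (α * θ)) ^ (2 / α) * Real.exp (θ * |z| ^ α) := by
    calc y ^ 2 * Real.exp (max (l * y) 0) ≤
        ((4 / (α * θ)) ^ (2 / α) * Real.exp (θ / 2 * |z| ^ α)) * Real.exp (θ / 2 * |z| ^ α) := by
          gcongr
          exact hsq.trans (sq_le_mul_exp_rpow hα hθ (abs_nonneg z))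
      _ = _ := by rw [mul_assoc, ← Real.exp_add]; ring_nf
  calc Real.exp (l * y) ≤ 1 + l * y + (l * y) ^ 2 * Real.exp (max (l * y) 0) :=
        exp_le_one_add_add_sq_mul_exp _
    _ = 1 + l * y + l ^ 2 * (y ^ 2 * Real.exp (max (l * y) 0)) := by ring
    _ ≤ _ := by gcongr

/-! ### Truncated Chernoff bound for stretched-exponential tails. -/

section Tail
variable {Ω : Type*} [MeasurableSpace Ω] {P : Measure Ω} [IsProbabilityMeasure P]

/-- Truncation from above only lowers the mean, so the linear term of the pointwise bound is
nonpositive and a sub-Gaussian estimate remains for the admissible `l`. -/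
lemma mgf_min_le {α θ t l B : ℝ} (hα : 0 < α) (hα1 : α ≤ 1) (hθ : 0 < θ) (ht : 0 < t)
    (hl : 0 ≤ l) (hlt : l ≤ θ / 2 * t ^ (α - 1)) {Z : Ω → ℝ} (hZ : Integrable Z P)
    (hZ0 : ∫ ω, Z ω ∂P ≤ 0) (hE : Integrable (fun ω => Real.exp (θ * |Z ω| ^ α)) P)
    (hB : ∫ ω, Real.exp (θ * |Z ω| ^ α) ∂P ≤ B) :
    mgf (fun ω => min (Z ω) t) P l ≤ Real.exp (l ^ 2 * ((4 / (α * θ)) ^ (2 / α) * B)) := by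
  set D := (4 / (α * θ)) ^ (2 / α)
  have hD : 0 ≤ D := by positivity
  have hint : Integrable (fun ω => 1 + l * Z ω + l ^ 2 * (D * Real.exp (θ * |Z ω| ^ α))) P :=
    ((integrable_const _).add (hZ.const_mul l)).add ((hE.const_mul D).const_mul _)
  calc mgf (fun ω => min (Z ω) t) P l
      ≤ ∫ ω, (1 + l * Z ω + l ^ 2 * (D * Real.exp (θ * |Z ω| ^ α))) ∂P := by
        refine integral_mono_of_nonneg (.of_forall fun ω => (Real.exp_pos _).le) hint
          (.of_forall fun ω => ?_)
        exact exp_mul_min_le hα hα1 hθ ht hl hlt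
    _ = 1 + l * ∫ ω, Z ω ∂P + l ^ 2 * (D * ∫ ω, Real.exp (θ * |Z ω| ^ α) ∂P) := by
        rw [integral_add (by exact (integrable_const _).add (hZ.const_mul l))
          ((hE.const_mul D).const_mul _), integral_add (integrable_const _) (hZ.const_mul l)]
        simp only [integral_const_mul, integral_const, probReal_univ, one_smul]
    _ ≤ 1 + l ^ 2 * (D * B) := by
        have : l * ∫ ω, Z ω ∂P ≤ 0 := mul_nonpos_of_nonneg_of_nonpos hl hZ0
        have : l ^ 2 * (D * ∫ ω, Real.exp (θ * |Z ω| ^ α) ∂P) ≤ l ^ 2 * (D * B) := by gcongr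
        linarith
    _ ≤ _ := by linarith [Real.add_one_le_exp (l ^ 2 * (D * B))]

lemma measureReal_lt_le_exp_rpow {α θ t B : ℝ} (hα : 0 < α) (hθ : 0 < θ) (ht : 0 < t)
    {Z : Ω → ℝ} (hE : Integrable (fun ω => Real.exp (θ * |Z ω| ^ α)) P)
    (hB : ∫ ω, Real.exp (θ * |Z ω| ^ α) ∂P ≤ B) :
    P.real {ω | t < Z ω} ≤ B * Real.exp (-(θ * t ^ α)) := by
  have h1 := mul_meas_ge_le_integral_of_nonneg (μ := P)
    (.of_forall fun ω => (Real.exp_pos (θ * |Z ω| ^ α)).le) hE (Real.exp (θ * t ^ α))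
  have h2 : P.real {ω | t < Z ω} ≤
      P.real {ω | Real.exp (θ * t ^ α) ≤ Real.exp (θ * |Z ω| ^ α)} := by
    refine measureReal_mono fun ω (hω : t < Z ω) => ?_
    simp only [Set.mem_ofPred_eq, Real.exp_le_exp]
    gcongr
    exact hω.le.trans (le_abs_self _)
  rw [Real.exp_neg, ← div_eq_mul_inv, le_div_iff₀ (Real.exp_pos _)]
  calc _ ≤ P.real {ω | Real.exp (θ * t ^ α) ≤ Real.exp (θ * |Z ω| ^ α)} *
        Real.exp (θ * t ^ α) := by gcongr
    _ ≤ B := by rw [mul_comm]; exact h1.trans hB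

/-- Concentration for sums of independent variables with stretched-exponential tails: before
adjusting the prefactor. -/
lemma measureReal_sum_ge_le_of_sq_ge {α θ B t : ℝ} (hα : 0 < α) (hα1 : α ≤ 1) (hθ : 0 < θ)
    (hB0 : 0 < B) {m : ℕ} (hm : 0 < m) {Z : Fin m → Ω → ℝ} (hind : iIndepFun Z P)
    (hZ : ∀ i, Integrable (Z i) P) (hZ0 : ∀ i, ∫ ω, Z i ω ∂P ≤ 0)
    (hE : ∀ i, Integrable (fun ω => Real.exp (θ * |Z i ω| ^ α)) P)
    (hB : ∀ i, ∫ ω, Real.exp (θ * |Z i ω| ^ α) ∂P ≤ B) (ht : 0 < t) (hmt : (m : ℝ) ≤ t ^ 2) :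
    P.real {ω | t ≤ ∑ i, Z i ω} ≤ (1 + B * (4 / (α * θ)) ^ (2 / α)) *
      Real.exp (-(min (1 / (4 * ((4 / (α * θ)) ^ (2 / α) * B))) (θ / 4) *
        min (t ^ 2 / m) (t ^ α))) := by
  set D := (4 / (α * θ)) ^ (2 / α) with hDdef
  have hD : 0 < D := by positivity
  set K := D * B with hK
  have hK0 : 0 < K := by positivity
  have hm0 : (0 : ℝ) < m := by exact_mod_cast hm
  set c := min (1 / (4 * K)) (θ / 4) with hc
  have hc0 : 0 ≤ c := by positivity
  set U := min (t ^ 2 / m) (t ^ α) with hU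
  have hU0 : 0 ≤ U := by positivity
  -- The first entry minimises the sub-Gaussian exponent `-l * t + m * K * l²`; the second is the
  -- largest `l` that the truncation allows.
  set l := min (t / (2 * K * m)) (θ / 2 * t ^ (α - 1)) with hl
  have hl0 : 0 ≤ l := by positivity
  set T : Fin m → Ω → ℝ := fun i ω => min (Z i ω) t with hT
  have hTind : iIndepFun T P :=
    hind.comp (fun _ x => min x t) fun _ => measurable_id.min measurable_const
  have hTm : ∀ i, AEMeasurable (T i) P := fun i =>
    (hZ i).aemeasurable.min aemeasurable_const
  have hlU : c * U ≤ l * t / 2 := by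
    rcases min_choice (t / (2 * K * m)) (θ / 2 * t ^ (α - 1)) with h | h
    · rw [hl, h]
      calc c * U ≤ 1 / (4 * K) * (t ^ 2 / m) := by
            gcongr
            · exact min_le_left _ _
            · exact min_le_left _ _
        _ = _ := by field_simp; ring
    · rw [hl, h]
      calc c * U ≤ θ / 4 * t ^ α := by
            gcongr
            · exact min_le_right _ _
            · exact min_le_right _ _
        _ = θ / 4 * (t ^ (α - 1) * t) := by
            rw [← Real.rpow_add_one ht.ne', sub_add_cancel]
        _ = _ := by ring
  have hchern : P.real {ω | t ≤ ∑ i, T i ω} ≤ Real.exp (-(c * U)) := by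
    have h1 := measure_ge_le_exp_mul_mgf (μ := P) (X := ∑ i, T i) t hl0
      (integrable_exp_mul_of_le l (∑ _i : Fin m, t) hl0
        (by simpa using Finset.aemeasurable_sum Finset.univ fun i _ => hTm i)
        (.of_forall fun ω => by
          rw [Finset.sum_apply]
          exact Finset.sum_le_sum fun i _ => min_le_right _ _))
    rw [hTind.mgf_sum₀ hTm] at h1
    simp only [Finset.sum_apply] at h1
    refine h1.trans ?_
    calc Real.exp (-l * t) * ∏ i, mgf (T i) P l
        ≤ Real.exp (-l * t) * ∏ i : Fin m, Real.exp (l ^ 2 * K) := by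
          gcongr with i
          · exact fun i _ => mgf_nonneg
          · exact mgf_min_le hα hα1 hθ ht hl0 (min_le_right _ _) (hZ i) (hZ0 i) (hE i) (hB i)
      _ = Real.exp (-l * t + m * (l ^ 2 * K)) := by
          rw [Finset.prod_const, Finset.card_univ, Fintype.card_fin, ← Real.exp_nat_mul,
            ← Real.exp_add]
      _ ≤ _ := by
          apply Real.exp_le_exp.mpr
          have h2 : l * (2 * K * m) ≤ t := by
            rw [← le_div_iff₀ (by positivity)]; exact min_le_left _ _
          have h3 : l * (l * (2 * K * m)) ≤ l * t := by gcongr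
          nlinarith
  -- If no summand exceeds `t`, truncation changes nothing.
  have hsub : {ω | t ≤ ∑ i, Z i ω} ⊆ {ω | t ≤ ∑ i, T i ω} ∪ ⋃ i, {ω | t < Z i ω} := by
    intro ω hω
    by_cases h : ∃ i, t < Z i ω
    · exact Or.inr (Set.mem_iUnion.mpr h)
    · push Not at h
      left
      have : ∀ i, T i ω = Z i ω := fun i => min_eq_left (h i)
      simpa [this] using hω
  have hunion : P.real (⋃ i, {ω | t < Z i ω}) ≤ B * D * Real.exp (-(c * U)) := by
    calc P.real (⋃ i, {ω | t < Z i ω}) ≤ ∑ i, P.real {ω | t < Z i ω} :=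
          measureReal_iUnion_fintype_le _
      _ ≤ ∑ i : Fin m, B * Real.exp (-(θ * t ^ α)) :=
          Finset.sum_le_sum fun i _ => measureReal_lt_le_exp_rpow hα hθ ht (hE i) (hB i)
      _ = m * (B * Real.exp (-(θ * t ^ α))) := by simp
      -- The union bound costs a factor `m ≤ t²`, absorbed by half of the exponential decay.
      _ ≤ (D * Real.exp (θ / 2 * t ^ α)) * (B * Real.exp (-(θ * t ^ α))) := by
          gcongr
          exact hmt.trans (sq_le_mul_exp_rpow hα hθ ht.le)
      _ = B * D * Real.exp (-(θ / 2 * t ^ α)) := by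
          rw [show -(θ / 2 * t ^ α) = θ / 2 * t ^ α + -(θ * t ^ α) by ring, Real.exp_add]; ring
      _ ≤ _ := by
          gcongr
          · exact (min_le_right _ _).trans (by linarith)
          · exact min_le_right _ _
  calc P.real {ω | t ≤ ∑ i, Z i ω}
      ≤ P.real ({ω | t ≤ ∑ i, T i ω} ∪ ⋃ i, {ω | t < Z i ω}) := measureReal_mono hsub
    _ ≤ _ := measureReal_union_le _ _
    _ ≤ Real.exp (-(c * U)) + B * D * Real.exp (-(c * U)) := add_le_add hchern hunion
    _ = _ := by ring

end Tail

/-- Concentration for sums of independent centred variables with stretched-exponential tails of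
exponent `α ≤ 1`. -/
theorem exists_stretched_exponential_tail {α θ B : ℝ} (hα : 0 < α) (hα1 : α ≤ 1) (hθ : 0 < θ)
    (hB0 : 0 < B) : ∃ c : ℝ, 0 < c ∧ ∀ {Ω : Type*} [MeasurableSpace Ω] (P : Measure Ω)
      [IsProbabilityMeasure P] {m : ℕ} {Z : Fin m → Ω → ℝ}, iIndepFun Z P →
      (∀ i, Integrable (Z i) P) → (∀ i, ∫ ω, Z i ω ∂P ≤ 0) →
      (∀ i, Integrable (fun ω => Real.exp (θ * |Z i ω| ^ α)) P) →
      (∀ i, ∫ ω, Real.exp (θ * |Z i ω| ^ α) ∂P ≤ B) → ∀ t : ℝ, 0 < t →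
      P.real {ω | t ≤ ∑ i, Z i ω} ≤ 2 * Real.exp (-(c * min (t ^ 2 / m) (t ^ α))) := by
  set D := (4 / (α * θ)) ^ (2 / α) with hDdef
  have hD : 0 < D := by positivity
  set c₀ := min (1 / (4 * (D * B))) (θ / 4) with hc₀
  have hc₀0 : 0 < c₀ := by positivity
  obtain ⟨c, hc, h⟩ := exists_prefactor_two (C := 1 + B * D + Real.exp c₀) (c := c₀)
    (by have := Real.exp_pos c₀; nlinarith [mul_pos hB0 hD]) hc₀0
  refine ⟨c, hc, fun {Ω} _ P _ {m Z} hind hZ hZ0 hE hB t ht => h _ _ measureReal_le_one ?_⟩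
  -- Otherwise `min (t ^ 2 / m) (t ^ α) ≤ 1` (for `m = 0` because `t ^ 2 / 0 = 0`), and the summand
  -- `exp c₀` in the prefactor makes the bound trivial.
  by_cases hm : 0 < m ∧ (m : ℝ) ≤ t ^ 2
  · refine (measureReal_sum_ge_le_of_sq_ge hα hα1 hθ hB0 hm.1 hind hZ hZ0 hE hB ht hm.2).trans ?_
    refine mul_le_mul_of_nonneg_right ?_ (Real.exp_pos _).le
    have := Real.exp_pos c₀
    linarith
  · have hU : min (t ^ 2 / m) (t ^ α) ≤ 1 := by
      refine (min_le_left _ _).trans ?_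
      rcases Nat.eq_zero_or_pos m with h0 | h0
      · simp [h0]
      · have h1 : t ^ 2 ≤ m := (not_le.mp fun h2 => hm ⟨h0, h2⟩).le
        exact div_le_one_of_le₀ h1 (by positivity)
    calc P.real {ω | t ≤ ∑ i, Z i ω} ≤ 1 := measureReal_le_one
      _ = Real.exp c₀ * Real.exp (-(c₀ * 1)) := by rw [← Real.exp_add]; simp
      _ ≤ _ := by
        refine mul_le_mul ?_ (Real.exp_le_exp.mpr ?_) (Real.exp_pos _).le ?_
        · nlinarith [mul_pos hB0 hD]
        · exact neg_le_neg (by gcongr)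
        · positivity

/-! ### Exponential moments of weighted averages of Gaussian powers. -/

/-- A weighted mean of nonnegative numbers, raised to any nonnegative power. -/
lemma rpow_weighted_sum_le {κ : Type*} [Fintype κ] {w v : κ → ℝ} (hw : ∀ k, 0 ≤ w k)
    (hw1 : ∑ k, w k = 1) (hv : ∀ k, 0 ≤ v k) {s : ℝ} (hs : 0 ≤ s) :
    (∑ k, w k * v k) ^ s ≤ 1 + ∑ k, w k * v k + ∑ k, w k * v k ^ s := by
  have hV : 0 ≤ ∑ k, w k * v k := Finset.sum_nonneg fun k _ => mul_nonneg (hw k) (hv k)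
  have hVs : 0 ≤ ∑ k, w k * v k ^ s :=
    Finset.sum_nonneg fun k _ => mul_nonneg (hw k) (Real.rpow_nonneg (hv k) s)
  rcases le_total 1 s with h | h
  · have := Real.rpow_arith_mean_le_arith_mean_rpow Finset.univ w v (fun k _ => hw k) hw1
      (fun k _ => hv k) h
    linarith
  · have : (∑ k, w k * v k) ^ s ≤ 1 + ∑ k, w k * v k := by
      rcases le_total (∑ k, w k * v k) 1 with h1 | h1
      · linarith [Real.rpow_le_one hV h1 hs]
      · have := Real.rpow_le_rpow_of_exponent_le h1 h
        rw [Real.rpow_one] at this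
        linarith
    linarith

/-- A substitute for Jensen's inequality for the function `v ↦ exp (θ * v ^ α)`, which is not
convex near the origin when `α < 1`. -/
lemma exp_rpow_weighted_sum_le {κ : Type*} [Fintype κ] {w v : κ → ℝ} (hw : ∀ k, 0 ≤ w k)
    (hw1 : ∑ k, w k = 1) (hv : ∀ k, 0 ≤ v k) {α θ : ℝ} (hα : 0 ≤ α) (hθ : 0 ≤ θ) :
    Real.exp (θ * (∑ k, w k * v k) ^ α) ≤
      Real.exp θ * (1 + ∑ k, w k * v k) + ∑ k, w k * Real.exp (θ * v k ^ α) := by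
  have hV : 0 ≤ ∑ k, w k * v k := Finset.sum_nonneg fun k _ => mul_nonneg (hw k) (hv k)
  have hser : ∀ x : ℝ, HasSum (fun j : ℕ => x ^ j / (j.factorial : ℝ)) (Real.exp x) := by
    intro x
    rw [Real.exp_eq_exp_ℝ]
    exact NormedSpace.expSeries_div_hasSum_exp x
  have hR : HasSum (fun j : ℕ => θ ^ j / (j.factorial : ℝ) * (1 + ∑ k, w k * v k) +
      ∑ k, w k * ((θ * v k ^ α) ^ j / (j.factorial : ℝ)))
      (Real.exp θ * (1 + ∑ k, w k * v k) + ∑ k, w k * Real.exp (θ * v k ^ α)) :=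
    ((hser θ).mul_right _).add (hasSum_sum fun k _ => (hser _).mul_left _)
  -- Compare the power series in `θ` term by term; the `j`-th term is the previous lemma with
  -- exponent `α * j`.
  refine hasSum_le (fun j => ?_) (hser _) hR
  have h1 := rpow_weighted_sum_le hw hw1 hv (s := α * j) (by positivity)
  rw [mul_pow, ← Real.rpow_mul_natCast hV]
  have h2 : ∀ k, w k * ((θ * v k ^ α) ^ j / (j.factorial : ℝ)) =
      θ ^ j / (j.factorial : ℝ) * (w k * v k ^ (α * j)) := by
    intro k
    rw [mul_pow, ← Real.rpow_mul_natCast (hv k)]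
    ring
  simp_rw [h2, ← Finset.mul_sum, ← mul_add]
  rw [mul_div_right_comm]
  gcongr

/-- The absolute moment `E|γ|^p` of a standard Gaussian. -/
noncomputable def gaussianAbsMoment (p : ℝ) : ℝ := ∫ x, |x| ^ p ∂(gaussianReal 0 1)

lemma integrable_abs_rpow_gaussianReal {p : ℝ} (hp : 0 < p) :
    Integrable (fun x : ℝ => |x| ^ p) (gaussianReal 0 1) := by
  have h := (memLp_id_gaussianReal' (μ := 0) (v := 1) (ENNReal.ofReal p)
    ENNReal.ofReal_ne_top).integrable_norm_rpow (by simpa using hp) ENNReal.ofReal_ne_top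
  simpa [ENNReal.toReal_ofReal hp.le] using h

lemma gaussianAbsMoment_nonneg (p : ℝ) : 0 ≤ gaussianAbsMoment p :=
  integral_nonneg fun x => Real.rpow_nonneg (abs_nonneg x) p

lemma HasLaw.integrable_comp {Ω 𝓧 : Type*} [MeasurableSpace Ω] [MeasurableSpace 𝓧]
    {P : Measure Ω} {μ : Measure 𝓧} {X : Ω → 𝓧} (hX : HasLaw X μ P) {f : 𝓧 → ℝ}
    (hf : Integrable f μ) : Integrable (fun ω => f (X ω)) P := by
  have h := hX.map_eq
  subst h
  exact hf.comp_aemeasurable hX.aemeasurable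

section Average
variable {Ω : Type*} [MeasurableSpace Ω] {P : Measure Ω} {κ : Type*} [Fintype κ] {w : κ → ℝ}
  {g : κ → Ω → ℝ} {p : ℝ}

lemma integrable_weighted_abs_rpow (hp : 0 < p) (hg : ∀ k, HasLaw (g k) (gaussianReal 0 1) P) :
    Integrable (fun ω => ∑ k, w k * |g k ω| ^ p) P :=
  integrable_finsetSum _ fun k _ =>
    (HasLaw.integrable_comp (hg k) (integrable_abs_rpow_gaussianReal hp)).const_mul _

lemma integral_weighted_abs_rpow (hp : 0 < p) (hw1 : ∑ k, w k = 1)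
    (hg : ∀ k, HasLaw (g k) (gaussianReal 0 1) P) :
    ∫ ω, ∑ k, w k * |g k ω| ^ p ∂P = gaussianAbsMoment p := by
  rw [integral_finsetSum _ fun k _ =>
    (HasLaw.integrable_comp (hg k) (integrable_abs_rpow_gaussianReal hp)).const_mul _]
  have h : ∀ k, ∫ ω, w k * |g k ω| ^ p ∂P = w k * gaussianAbsMoment p := by
    intro k
    rw [integral_const_mul]
    congr 1
    exact (hg k).integral_comp (f := fun x => |x| ^ p)
      (integrable_abs_rpow_gaussianReal hp).aestronglyMeasurable
  simp_rw [h, ← Finset.sum_mul, hw1, one_mul]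

end Average

/-- Stretched-exponential moments of weighted averages of `p`-th powers of Gaussians are bounded
uniformly in the weights and in the joint law. -/
lemma exists_exp_moment_weighted_abs_rpow {p : ℝ} (hp : 1 ≤ p) :
    ∃ θ B : ℝ, 0 < θ ∧ 0 < B ∧ ∀ {Ω : Type*} [MeasurableSpace Ω] {P : Measure Ω}
      [IsProbabilityMeasure P] {κ : Type*} [Fintype κ] {w : κ → ℝ} {g : κ → Ω → ℝ},
      (∀ k, 0 ≤ w k) → ∑ k, w k = 1 → (∀ k, HasLaw (g k) (gaussianReal 0 1) P) →
      Integrable (fun ω => Real.exp (θ * (∑ k, w k * |g k ω| ^ p) ^ (min 1 (2 / p)))) P ∧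
      ∫ ω, Real.exp (θ * (∑ k, w k * |g k ω| ^ p) ^ (min 1 (2 / p))) ∂P ≤ B := by
  have hp0 : 0 < p := by linarith
  -- Fernique's theorem supplies `θ`; the exponent `α` is such that `(|x| ^ p) ^ α` grows at most
  -- quadratically.
  obtain ⟨θ, hθ, hint⟩ := IsGaussian.exists_integrable_exp_sq (gaussianReal 0 1)
  set α := min 1 (2 / p) with hα
  have hα0 : 0 < α := by positivity
  have hpα : p * α ≤ 2 := by
    calc p * α ≤ p * (2 / p) := by gcongr; exact min_le_right _ _
      _ = 2 := by field_simp
  set M := gaussianAbsMoment p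
  have hM : 0 ≤ M := gaussianAbsMoment_nonneg p
  set G := ∫ x, Real.exp (θ * ‖x‖ ^ 2) ∂(gaussianReal 0 1) with hG
  have hG0 : 0 ≤ G := integral_nonneg fun x => (Real.exp_pos _).le
  refine ⟨θ, Real.exp θ * (1 + M) + Real.exp θ * G, hθ, by positivity, ?_⟩
  intro Ω _ P _ κ _ w g hw hw1 hg
  have hpt : ∀ x : ℝ, Real.exp (θ * (|x| ^ p) ^ α) ≤ Real.exp θ * Real.exp (θ * ‖x‖ ^ 2) := by
    intro x
    rw [← Real.exp_add, ← Real.rpow_mul (abs_nonneg x), Real.norm_eq_abs]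
    apply Real.exp_le_exp.mpr
    have h0 : |x| ^ (p * α) ≤ 1 + |x| ^ 2 := by
      rcases le_total |x| 1 with h | h
      · have := Real.rpow_le_one (abs_nonneg x) h (by positivity : 0 ≤ p * α)
        nlinarith [sq_nonneg |x|]
      · have := Real.rpow_le_rpow_of_exponent_le h hpα
        rw [Real.rpow_two] at this
        linarith
    nlinarith
  have hVint := integrable_weighted_abs_rpow (w := w) hp0 hg
  have hgi : ∀ k, Integrable (fun ω => Real.exp (θ * ‖g k ω‖ ^ 2)) P := fun k =>
    HasLaw.integrable_comp (hg k) hint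
  have hbound : ∀ ω, Real.exp (θ * (∑ k, w k * |g k ω| ^ p) ^ α) ≤
      Real.exp θ * (1 + ∑ k, w k * |g k ω| ^ p) +
        ∑ k, w k * (Real.exp θ * Real.exp (θ * ‖g k ω‖ ^ 2)) := by
    intro ω
    refine (exp_rpow_weighted_sum_le hw hw1
      (fun k => Real.rpow_nonneg (abs_nonneg (g k ω)) p) hα0.le hθ.le).trans ?_
    gcongr with k
    · exact hw k
    · exact hpt _
  have hI1 : Integrable (fun ω => Real.exp θ * (1 + ∑ k, w k * |g k ω| ^ p)) P :=
    ((integrable_const _).add hVint).const_mul _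
  have hI2 : Integrable
      (fun ω => ∑ k, w k * (Real.exp θ * Real.exp (θ * ‖g k ω‖ ^ 2))) P :=
    integrable_finsetSum _ fun k _ => ((hgi k).const_mul _).const_mul _
  have hI := hI1.add hI2
  have hmeas : AEStronglyMeasurable
      (fun ω => Real.exp (θ * (∑ k, w k * |g k ω| ^ p) ^ α)) P := by
    have := hVint.aemeasurable
    exact (Real.measurable_exp.comp_aemeasurable
      ((this.pow_const α).const_mul θ)).aestronglyMeasurable
  refine ⟨hI.mono' hmeas (.of_forall fun ω => ?_), ?_⟩
  · rw [Real.norm_of_nonneg (Real.exp_pos _).le]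
    exact hbound ω
  · refine (integral_mono_of_nonneg (.of_forall fun ω => (Real.exp_pos _).le) hI
      (.of_forall hbound)).trans (le_of_eq ?_)
    simp only [Pi.add_apply]
    rw [integral_add hI1 hI2, integral_const_mul, integral_add (integrable_const _) hVint,
      integral_weighted_abs_rpow hp0 hw1 hg,
      integral_finsetSum _ fun k _ => ((hgi k).const_mul _).const_mul _]
    have h : ∀ k, ∫ ω, w k * (Real.exp θ * Real.exp (θ * ‖g k ω‖ ^ 2)) ∂P =
        w k * (Real.exp θ * G) := by
      intro k
      rw [integral_const_mul, integral_const_mul]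
      congr 2
      exact (hg k).integral_comp (f := fun x => Real.exp (θ * ‖x‖ ^ 2)) hint.aestronglyMeasurable
    simp_rw [h, ← Finset.sum_mul, hw1, one_mul]
    simp [M]

/-! ### Concentration of normalised empirical means. -/

/-- Concentration of empirical means of independent variables of mean one dominated by weighted
averages of `p`-th powers of Gaussians; the sign `s` selects the upper or the lower tail. -/
theorem exists_tail_of_abs_le_weighted_abs_rpow {p : ℝ} (hp : 1 ≤ p) :
    ∃ c : ℝ, 0 < c ∧ ∀ {Ω : Type*} [MeasurableSpace Ω] (P : Measure Ω) [IsProbabilityMeasure P]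
      {m n : ℕ} {w : Fin n → ℝ} {g : Fin m → Fin n → Ω → ℝ} {Y : Fin m → Ω → ℝ} {R ε s : ℝ},
      (∀ k, 0 ≤ w k) → ∑ k, w k = 1 → (∀ i k, HasLaw (g i k) (gaussianReal 0 1) P) →
      iIndepFun Y P → (∀ i, AEMeasurable (Y i) P) → (∀ i, ∫ ω, Y i ω ∂P = 1) →
      (∀ i ω, |Y i ω| ≤ R * ∑ k, w k * |g i k ω| ^ p) → 0 < ε → ε ≤ 1 → |s| = 1 →
      P.real {ω | m * ε ≤ ∑ i, s * (Y i ω - 1)} ≤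
        2 * Real.exp (-(c * min ((m : ℝ) * ε ^ 2 * R ^ (-2 : ℤ))
          ((m : ℝ) ^ (min 1 (2 / p)) * ε ^ (2 / p) * R ^ (-(2 / p))))) := by
  have hp0 : 0 < p := by linarith
  obtain ⟨θ, B, hθ, hB, hmom⟩ := exists_exp_moment_weighted_abs_rpow hp
  set α := min 1 (2 / p) with hα
  have hα0 : 0 < α := by positivity
  have hα1 : α ≤ 1 := min_le_left _ _
  set M := gaussianAbsMoment p with hMdef
  have hM : 0 ≤ M := gaussianAbsMoment_nonneg p
  obtain ⟨c, hc, htail⟩ := exists_stretched_exponential_tail hα0 hα1 hθ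
    (by positivity : 0 < Real.exp (θ * M ^ α) * B)
  -- The factor `1 / (M + 1)` pays for `p ≤ 2`, where the tail exponent is `1` but the target has
  -- powers `2 / p`.
  refine ⟨c * min 1 (1 / (M + 1)), by positivity, ?_⟩
  intro Ω _ P _ m n w g Y R ε s hw hw1 hg hind hYm hY1 hYle hε hε1 hs
  rcases Nat.eq_zero_or_pos m with rfl | hm
  · rw [show ((0 : ℕ) : ℝ) = 0 from Nat.cast_zero, Real.zero_rpow hα0.ne']
    simp only [zero_mul, min_self, mul_zero, neg_zero, Real.exp_zero]
    exact measureReal_le_one.trans (by norm_num)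
  have hm0 : (0 : ℝ) < m := by exact_mod_cast hm
  set V : Fin m → Ω → ℝ := fun i ω => ∑ k, w k * |g i k ω| ^ p with hV
  have hV0 : ∀ i ω, 0 ≤ V i ω := fun i ω =>
    Finset.sum_nonneg fun k _ => mul_nonneg (hw k) (Real.rpow_nonneg (abs_nonneg _) _)
  have hVint : ∀ i, Integrable (V i) P := fun i => integrable_weighted_abs_rpow hp0 (hg i)
  have hYint : ∀ i, Integrable (Y i) P := fun i =>
    ((hVint i).const_mul R).mono' (hYm i).aestronglyMeasurable (.of_forall fun ω => hYle i ω)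
  -- Integrating the domination of `Y` forces `R` to be bounded below, so that `1 / R` is controlled
  -- by a constant depending only on `p`.
  have hRM : 1 ≤ R * M := by
    have h1 : ∫ ω, Y ⟨0, hm⟩ ω ∂P ≤ ∫ ω, R * V ⟨0, hm⟩ ω ∂P :=
      integral_mono (hYint _) ((hVint _).const_mul R)
        fun ω => (le_abs_self _).trans (hYle _ ω)
    rwa [hY1, integral_const_mul, integral_weighted_abs_rpow hp0 hw1 (hg _)] at h1
  have hR : 0 < R := by
    by_contra! h
    nlinarith
  have hRinv : 1 / R ≤ M := by rw [div_le_iff₀ hR]; linarith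
  -- Dividing by `R` gives a domination by `V + M`, with constants free of `R`.
  set Z : Fin m → Ω → ℝ := fun i ω => s / R * (Y i ω - 1) with hZ
  have hZabs : ∀ i ω, |Z i ω| ≤ V i ω + M := by
    intro i ω
    rw [hZ]
    simp only [abs_mul, abs_div, hs, abs_of_pos hR]
    calc 1 / R * |Y i ω - 1| ≤ 1 / R * (R * V i ω + 1) := by
          gcongr
          refine (abs_sub _ _).trans ?_
          rw [abs_one]
          gcongr
          exact hYle i ω
      _ = V i ω + 1 / R := by field_simp
      _ ≤ _ := by gcongr
  have hZint : ∀ i, Integrable (Z i) P := fun i =>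
    ((hYint i).sub (integrable_const 1)).const_mul _
  have hZ0 : ∀ i, ∫ ω, Z i ω ∂P ≤ 0 := fun i => by
    rw [hZ]
    simp only
    rw [integral_const_mul, integral_sub (hYint i) (integrable_const 1), hY1]
    simp
  have hZind : iIndepFun Z P :=
    hind.comp (fun _ x => s / R * (x - 1)) fun _ => by fun_prop
  have hpt : ∀ i ω, Real.exp (θ * |Z i ω| ^ α) ≤
      Real.exp (θ * M ^ α) * Real.exp (θ * V i ω ^ α) := by
    intro i ω
    rw [← Real.exp_add, ← mul_add]
    gcongr
    calc |Z i ω| ^ α ≤ (M + V i ω) ^ α := by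
          gcongr
          rw [add_comm]
          exact hZabs i ω
      _ ≤ _ := Real.rpow_add_le_add_rpow hM (hV0 i ω) hα0.le hα1
  have hVexp := fun i => hmom (P := P) hw hw1 (hg i)
  have hEdom := fun i => (hVexp i).1.const_mul (Real.exp (θ * M ^ α))
  have hE : ∀ i, Integrable (fun ω => Real.exp (θ * |Z i ω| ^ α)) P := fun i =>
    (hEdom i).mono' (Real.measurable_exp.comp_aemeasurable
      (((hZint i).aemeasurable.abs.pow_const α).const_mul θ)).aestronglyMeasurable
      (.of_forall fun ω => by
        rw [Real.norm_of_nonneg (Real.exp_pos _).le]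
        exact hpt i ω)
  have hEB : ∀ i, ∫ ω, Real.exp (θ * |Z i ω| ^ α) ∂P ≤ Real.exp (θ * M ^ α) * B := fun i => by
    refine (integral_mono (hE i) (hEdom i) (hpt i)).trans ?_
    rw [integral_const_mul]
    gcongr
    exact (hVexp i).2
  have hmain := htail P hZind hZint hZ0 hE hEB (m * ε / R) (by positivity)
  have hset : {ω | m * ε ≤ ∑ i, s * (Y i ω - 1)} = {ω | m * ε / R ≤ ∑ i, Z i ω} := by
    ext ω
    have : ∑ i, Z i ω = (∑ i, s * (Y i ω - 1)) / R := by
      rw [Finset.sum_div]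
      exact Finset.sum_congr rfl fun i _ => by simp only [hZ]; ring
    simp only [Set.mem_ofPred_eq, this]
    rw [div_le_div_iff_of_pos_right hR]
  rw [hset]
  refine hmain.trans ?_
  have hsq : (m * ε / R) ^ 2 / m = (m : ℝ) * ε ^ 2 * R ^ (-2 : ℤ) := by
    rw [zpow_neg]
    field_simp
  have hcmp : min 1 (1 / (M + 1)) * min ((m : ℝ) * ε ^ 2 * R ^ (-2 : ℤ))
      ((m : ℝ) ^ α * ε ^ (2 / p) * R ^ (-(2 / p))) ≤
      min ((m * ε / R) ^ 2 / m) ((m * ε / R) ^ α) := by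
    have hA : 0 ≤ (m : ℝ) * ε ^ 2 * R ^ (-2 : ℤ) := by positivity
    have hA2 : 0 ≤ (m : ℝ) ^ α * ε ^ (2 / p) * R ^ (-(2 / p)) := by positivity
    have hone : min 1 (1 / (M + 1)) ≤ 1 := min_le_left _ _
    rw [hsq]
    refine le_min ?_ ?_
    · calc _ ≤ 1 * ((m : ℝ) * ε ^ 2 * R ^ (-2 : ℤ)) := by
            gcongr
            exact min_le_left _ _
        _ = _ := one_mul _
    -- For `p ≤ 2` the linear term `m * ε / R` is compared with the quadratic one, since `ε / R ≤
    -- M`; for `p ≥ 2` the two second entries agree exactly.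
    · rcases le_total 1 (2 / p) with h | h
      · have hα' : α = 1 := min_eq_left h
        rw [hα', Real.rpow_one ((m : ℝ) * ε / R)]
        calc _ ≤ 1 / (M + 1) * ((m : ℝ) * ε ^ 2 * R ^ (-2 : ℤ)) := by
              gcongr
              · exact min_le_right _ _
              · exact min_le_left _ _
          _ = (m * ε / R) * (ε * (1 / R) / (M + 1)) := by
              rw [zpow_neg]
              field_simp
          _ ≤ (m * ε / R) * 1 := by
              gcongr
              apply div_le_one_of_le₀ _ (by positivity)
              nlinarith [one_div_pos.mpr hR]
          _ = _ := mul_one _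
      · have hα' : α = 2 / p := min_eq_right h
        calc _ ≤ 1 * ((m : ℝ) ^ α * ε ^ (2 / p) * R ^ (-(2 / p))) := by
              gcongr
              exact min_le_right _ _
          _ = _ := by
              rw [hα', one_mul, Real.div_rpow (by positivity) hR.le,
                Real.mul_rpow hm0.le hε.le, Real.rpow_neg hR.le]
              rfl
  have := mul_le_mul_of_nonneg_left hcmp hc.le
  refine mul_le_mul_of_nonneg_left (Real.exp_le_exp.mpr ?_) zero_le_two
  linarith

/-! ### Deterministic control of the stable rank. -/

lemma frobNorm_sq {m n : ℕ} (A : Matrix (Fin m) (Fin n) ℝ) :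
    frobNorm A ^ 2 = ∑ i, ∑ t, A i t ^ 2 := by
  have h : 0 ≤ ∑ i, ∑ t, A i t ^ 2 := by positivity
  rw [frobNorm, Matrix.frobenius_norm_def, ← Real.sqrt_eq_rpow]
  simp only [Real.norm_eq_abs, Real.rpow_two, sq_abs]
  exact Real.sq_sqrt h

lemma opNorm_zero {m n : ℕ} : opNorm (0 : Matrix (Fin m) (Fin n) ℝ) = 0 := by
  let := Matrix.instL2OpNormedAddCommGroup (m := Fin m) (n := Fin n) (𝕜 := ℝ)
  exact norm_zero

/-- Testing the operator norm against the all-ones vector on the left. -/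
lemma sq_sum_mulVec_le {m n : ℕ} (A : Matrix (Fin m) (Fin n) ℝ) (v : Fin n → ℝ) :
    (∑ i, ∑ t, v t * A i t) ^ 2 ≤ m * opNorm A ^ 2 * ∑ t, v t ^ 2 := by
  have h1 := Matrix.l2_opNorm_mulVec A (WithLp.toLp 2 v)
  have h2 : ‖(EuclideanSpace.equiv (Fin m) ℝ).symm (A.mulVec v)‖ ^ 2 =
      ∑ i, (∑ t, v t * A i t) ^ 2 := by
    rw [EuclideanSpace.norm_sq_eq]
    refine Finset.sum_congr rfl fun i _ => ?_
    rw [Real.norm_eq_abs, sq_abs]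
    congr 1
    simp [Matrix.mulVec, dotProduct, mul_comm]
  have h3 : ‖WithLp.toLp 2 v‖ ^ 2 = ∑ t, v t ^ 2 := by
    rw [EuclideanSpace.norm_sq_eq]
    simp
  have h4 : ∑ i, (∑ t, v t * A i t) ^ 2 ≤ opNorm A ^ 2 * ∑ t, v t ^ 2 := by
    rw [← h2, ← h3, ← mul_pow]
    exact pow_le_pow_left₀ (norm_nonneg _) h1 2
  -- Cauchy–Schwarz against the all-ones vector produces the factor `m`.
  have h5 := sq_sum_le_card_mul_sum_sq (s := Finset.univ) (f := fun i : Fin m => ∑ t, v t * A i t)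
  rw [Finset.card_univ, Fintype.card_fin] at h5
  rw [mul_assoc]
  exact h5.trans (by gcongr)

/-- A lower bound for a bilinear form and an upper bound for the Frobenius norm control the stable
rank. -/
lemma stableRank_le_of_bounds {m n : ℕ} {A : Matrix (Fin m) (Fin n) ℝ} {v : Fin n → ℝ}
    {E δ η : ℝ} (hm : 0 < m) (hS : 0 < ∑ t, v t ^ 2) (hδ : 0 < δ)
    (hlow : m * δ * ∑ t, v t ^ 2 ≤ ∑ i, ∑ t, v t * A i t)
    (hup : ∑ i, ∑ t, A i t ^ 2 ≤ m * η * E) :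
    A ≠ 0 ∧ stableRank A ≤ η / δ ^ 2 * (E / ∑ t, v t ^ 2) := by
  set S := ∑ t, v t ^ 2
  have hm0 : (0 : ℝ) < m := by exact_mod_cast hm
  have h1 : (m * δ * S) ^ 2 ≤ m * opNorm A ^ 2 * S :=
    (pow_le_pow_left₀ (by positivity) hlow 2).trans (sq_sum_mulVec_le A v)
  have h2 : m * δ ^ 2 * S ≤ opNorm A ^ 2 := by
    have : (m * δ ^ 2 * S) * (m * S) ≤ opNorm A ^ 2 * (m * S) := by nlinarith
    exact le_of_mul_le_mul_right this (by positivity)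
  have hpos : 0 < m * δ ^ 2 * S := by positivity
  have hη : 0 ≤ m * η * E := le_trans (by positivity) hup
  refine ⟨?_, ?_⟩
  · rintro rfl
    rw [opNorm_zero] at h2
    nlinarith
  · rw [stableRank, frobNorm_sq]
    calc (∑ i, ∑ t, A i t ^ 2) / opNorm A ^ 2 ≤ (m * η * E) / (m * δ ^ 2 * S) := by gcongr
      _ = _ := by field_simp

/-! ### Independence of rows and laws of pre-activations. -/

section Weights
variable {Ω : Type*} [MeasurableSpace Ω] {P : Measure Ω} {m d n : ℕ}
  {W : Ω → Matrix (Fin m) (Fin d) ℝ}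

lemma IsGaussianWeight.aemeasurable_row (hW : IsGaussianWeight W P) (i : Fin m) :
    AEMeasurable (fun ω j => W ω i j) P :=
  aemeasurable_pi_lambda _ fun j => (hW.law i j).aemeasurable

/-- The joint law of all entries is a product over index pairs; currying turns it into a product
over rows of product laws, which characterises independence of the rows. -/
lemma IsGaussianWeight.iIndepFun_row (hW : IsGaussianWeight W P) :
    iIndepFun (fun (i : Fin m) ω (j : Fin d) => W ω i j) P := by
  have := hW.indep.isProbabilityMeasure
  set γ := gaussianReal 0 (1 / (d : NNReal))
  have hrow : ∀ i, HasLaw (fun ω (j : Fin d) => W ω i j) (Measure.pi fun _ => γ) P := fun i =>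
    iIndepFun.hasLaw_pi (fun j => hW.law i j)
      (hW.indep.precomp (g := fun j => (i, j)) fun _ _ h => (Prod.ext_iff.mp h).2)
  rw [iIndepFun_iff_hasLaw_pi_pi hrow]
  have hall := iIndepFun.hasLaw_pi (fun ij : Fin m × Fin d => hW.law ij.1 ij.2) hW.indep
  refine ⟨aemeasurable_pi_lambda _ fun i => hW.aemeasurable_row i, ?_⟩
  have hcurry := Measure.infinitePi_map_curry (fun (_ : Fin m) (_ : Fin d) => γ)
  simp only [Measure.infinitePi_eq_pi] at hcurry
  rw [← hcurry, ← hall.map_eq, AEMeasurable.map_map_of_aemeasurable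
    (MeasurableEquiv.measurable _).aemeasurable hall.aemeasurable]
  rfl

lemma hasLaw_sum_mul_gaussianReal {ι : Type*} {Z : ι → Ω → ℝ} {v : NNReal}
    (hind : iIndepFun Z P) (hZ : ∀ j, HasLaw (Z j) (gaussianReal 0 v) P) (x : ι → ℝ)
    (s : Finset ι) :
    HasLaw (fun ω => ∑ j ∈ s, Z j ω * x j)
      (gaussianReal 0 (∑ j ∈ s, .mk (x j ^ 2) (sq_nonneg _) * v)) P := by
  classical
  have := hind.isProbabilityMeasure
  induction s using Finset.induction_on with
  | empty =>
    simp only [Finset.sum_empty, gaussianReal_zero_var]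
    exact hasLaw_dirac_of_ae_eq (by rfl)
  | insert i s hi ih =>
    have hi' := gaussianReal_mul_const (hZ i) (x i)
    rw [mul_zero] at hi'
    have hmul : iIndepFun (fun j ω => Z j ω * x j) P :=
      hind.comp (fun j z => z * x j) fun j => by fun_prop
    have hI := hmul.indepFun_finsetSum_of_notMem₀
      (fun j => (hZ j).aemeasurable.mul_const (x j)) hi
    have hsum : (∑ j ∈ s, fun ω => Z j ω * x j) = fun ω => ∑ j ∈ s, Z j ω * x j := by
      ext ω; simp
    rw [hsum] at hI
    have h := gaussianReal_add_gaussianReal_of_indepFun hI.symm hi'.map_eq ih.map_eq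
    have hfun : (fun ω => ∑ j ∈ insert i s, Z j ω * x j) =
        (fun ω => Z i ω * x i) + fun ω => ∑ j ∈ s, Z j ω * x j := by
      ext ω; simp [Finset.sum_insert hi]
    rw [hfun, Finset.sum_insert hi]
    exact ⟨hi'.aemeasurable.add ih.aemeasurable, by simpa using h⟩

lemma colNorm_sq {d n : ℕ} (X : Matrix (Fin d) (Fin n) ℝ) (t : Fin n) :
    colNorm X t ^ 2 = ∑ j, X j t ^ 2 := by
  rw [colNorm, EuclideanSpace.norm_sq_eq]
  simp [Matrix.col]

lemma rows_pos_of_col_ne_zero {d n : ℕ} {X : Matrix (Fin d) (Fin n) ℝ} {t : Fin n}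
    (h : X.col t ≠ 0) : 0 < d := by
  rcases Nat.eq_zero_or_pos d with rfl | hd
  · exact absurd (Subsingleton.elim _ _) h
  · exact hd

lemma colNorm_pos {d n : ℕ} {X : Matrix (Fin d) (Fin n) ℝ} {t : Fin n} (h : X.col t ≠ 0) :
    0 < colNorm X t := by
  rw [colNorm, norm_pos_iff]
  simpa using h

lemma scale_pos {d n : ℕ} {X : Matrix (Fin d) (Fin n) ℝ} {t : Fin n} (h : X.col t ≠ 0) :
    0 < 1 / √(d : ℝ) * colNorm X t := by
  have hd0 : (0 : ℝ) < d := by exact_mod_cast rows_pos_of_col_ne_zero h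
  have := colNorm_pos h
  positivity

/-- The rescaled pre-activations are standard Gaussians. -/
lemma IsGaussianWeight.hasLaw_div (hW : IsGaussianWeight W P) {X : Matrix (Fin d) (Fin n) ℝ}
    {t : Fin n} (hX : X.col t ≠ 0) (i : Fin m) :
    HasLaw (fun ω => (W ω * X) i t / (1 / √(d : ℝ) * colNorm X t)) (gaussianReal 0 1) P := by
  have hd := rows_pos_of_col_ne_zero hX
  have hd0 : (0 : ℝ) < d := by exact_mod_cast hd
  have hc := colNorm_pos hX
  have h1 := hasLaw_sum_mul_gaussianReal
    (hW.indep.precomp (g := fun j => (i, j)) fun _ _ h => (Prod.ext_iff.mp h).2)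
    (fun j => hW.law i j) (fun j => X j t) Finset.univ
  have h2 := gaussianReal_div_const h1 (1 / √(d : ℝ) * colNorm X t)
  simp only [zero_div] at h2
  have hfun : (fun ω => (W ω * X) i t / (1 / √(d : ℝ) * colNorm X t)) =
      fun ω => (∑ j, W ω i j * X j t) / (1 / √(d : ℝ) * colNorm X t) := by
    ext ω; rw [Matrix.mul_apply]
  rw [hfun]
  convert h2 using 2
  apply NNReal.coe_injective
  have hsq : (√(d : ℝ)) ^ 2 = d := Real.sq_sqrt hd0.le
  have hsum := colNorm_sq X t
  have hne : (∑ j, X j t ^ 2) ≠ 0 := by rw [← hsum]; positivity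
  push_cast
  rw [← Finset.sum_mul, mul_pow, div_pow, hsq, hsum]
  field_simp

end Weights

/-! ### Range of the column scales. -/

section Scales
variable {d n : ℕ} {X : Matrix (Fin d) (Fin n) ℝ}

lemma scale_mem_Icc (X : Matrix (Fin d) (Fin n) ℝ) (t : Fin n) :
    1 / √(d : ℝ) * colNorm X t ∈ Set.Icc (minScale X) (maxScale X) := by
  constructor
  · exact mul_le_mul_of_nonneg_left (ciInf_le (Set.finite_range _).bddBelow t) (by positivity)
  · exact mul_le_mul_of_nonneg_left (le_ciSup (Set.finite_range _).bddAbove t) (by positivity)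

lemma minScale_pos (hn : 0 < n) (hX : ∀ t, X.col t ≠ 0) : 0 < minScale X := by
  have : Nonempty (Fin n) := ⟨⟨0, hn⟩⟩
  obtain ⟨t, ht⟩ := exists_eq_ciInf_of_finite (f := fun t => colNorm X t)
  rw [minScale, ← ht]
  exact scale_pos (hX t)

end Scales

/-! ### Gaussian moments of the activation. -/

section Activation
variable {σ : ℝ → ℝ} {L p : ℝ}

lemma growth_const_nonneg (hL : ∀ t, |σ t| ≤ L * |t| ^ p) : 0 ≤ L := by
  have := (abs_nonneg _).trans (hL 1)
  simpa using this

lemma abs_activation_le (hL : ∀ t, |σ t| ≤ L * |t| ^ p) {s : ℝ} (hs : 0 < s) (x : ℝ) :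
    |σ (s * x)| ≤ L * s ^ p * |x| ^ p := by
  refine (hL _).trans (le_of_eq ?_)
  rw [abs_mul, abs_of_pos hs, Real.mul_rpow hs.le (abs_nonneg x), mul_assoc]

lemma sq_activation_le (hL : ∀ t, |σ t| ≤ L * |t| ^ p) {s : ℝ} (hs : 0 < s) (x : ℝ) :
    σ (s * x) ^ 2 ≤ (L * s ^ p) ^ 2 * |x| ^ (2 * p) := by
  rw [← sq_abs, mul_comm 2 p, Real.rpow_mul (abs_nonneg x), Real.rpow_two, ← mul_pow]
  exact pow_le_pow_left₀ (abs_nonneg _) (abs_activation_le hL hs x) 2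

lemma integrable_activation (hσ : Measurable σ) (hL : ∀ t, |σ t| ≤ L * |t| ^ p) (hp : 0 < p)
    {s : ℝ} (hs : 0 < s) : Integrable (fun x => σ (s * x)) (gaussianReal 0 1) :=
  ((integrable_abs_rpow_gaussianReal hp).const_mul (L * s ^ p)).mono'
    (hσ.comp (measurable_const_mul s)).aestronglyMeasurable
    (.of_forall fun x => abs_activation_le hL hs x)

lemma integrable_activation_sq (hσ : Measurable σ) (hL : ∀ t, |σ t| ≤ L * |t| ^ p) (hp : 0 < p)
    {s : ℝ} (hs : 0 < s) : Integrable (fun x => σ (s * x) ^ 2) (gaussianReal 0 1) :=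
  ((integrable_abs_rpow_gaussianReal (p := 2 * p) (by linarith)).const_mul ((L * s ^ p) ^ 2)).mono'
    ((hσ.comp (measurable_const_mul s)).pow_const 2).aestronglyMeasurable
    (.of_forall fun x => by
      rw [Real.norm_of_nonneg (sq_nonneg _)]
      exact sq_activation_le hL hs x)

/-- Nonnegativity of the variance. It lets a growth bound relative to the squared mean serve
relative to the second moment. -/
lemma gaussianExp_sq_le (hσ : Measurable σ) (hL : ∀ t, |σ t| ≤ L * |t| ^ p) (hp : 0 < p)
    {s : ℝ} (hs : 0 < s) :
    gaussianExp (fun x => σ (s * x)) ^ 2 ≤ gaussianExp (fun x => σ (s * x) ^ 2) := by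
  have hmem : MemLp (fun x => σ (s * x)) 2 (gaussianReal 0 1) :=
    (memLp_two_iff_integrable_sq (hσ.comp (measurable_const_mul s)).aestronglyMeasurable).mpr
      (integrable_activation_sq hσ hL hp hs)
  have h := variance_nonneg (fun x => σ (s * x)) (gaussianReal 0 1)
  rw [variance_eq_sub hmem] at h
  simpa [gaussianExp] using h

lemma gaussianExp_sq_le_moment (hσ : Measurable σ) (hL : ∀ t, |σ t| ≤ L * |t| ^ p) (hp : 0 < p)
    {s : ℝ} (hs : 0 < s) :
    gaussianExp (fun x => σ (s * x) ^ 2) ≤ (L * s ^ p) ^ 2 * gaussianAbsMoment (2 * p) := by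
  rw [gaussianExp, gaussianAbsMoment, ← integral_const_mul]
  exact integral_mono (integrable_activation_sq hσ hL hp hs)
    ((integrable_abs_rpow_gaussianReal (by linarith)).const_mul _)
    fun x => sq_activation_le hL hs x

variable {a b q s : ℝ}

lemma gaussianKappa_mul_le (ha : 0 < a) (hs : s ∈ Set.Icc a b) :
    gaussianKappa σ q a b * s ^ q ≤ |gaussianExp (fun x => σ (s * x))| := by
  have hs0 : 0 < s := ha.trans_le hs.1
  rw [← le_div_iff₀ (by positivity)]
  refine ciInf_le (f := fun s : Set.Icc a b =>
    |gaussianExp (fun x => σ ((s : ℝ) * x))| / (s : ℝ) ^ q) ⟨0, ?_⟩ ⟨s, hs⟩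
  rintro _ ⟨u, rfl⟩
  exact div_nonneg (abs_nonneg _) (Real.rpow_nonneg (ha.le.trans u.2.1) _)

lemma gaussianExp_ne_zero (ha : 0 < a) (hκ : 0 < gaussianKappa σ q a b) (hs : s ∈ Set.Icc a b) :
    gaussianExp (fun x => σ (s * x)) ≠ 0 := by
  have hs0 : 0 < s := ha.trans_le hs.1
  have h := gaussianKappa_mul_le (σ := σ) (q := q) ha hs
  exact abs_pos.mp (lt_of_lt_of_le (by positivity) h)

lemma rpow_le_iSup_Icc (ha : 0 < a) (hs : s ∈ Set.Icc a b) (y : ℝ) :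
    s ^ y ≤ ⨆ u : Set.Icc a b, (u : ℝ) ^ y := by
  have hc : ContinuousOn (fun u : ℝ => u ^ y) (Set.Icc a b) := fun u hu =>
    (Real.continuousAt_rpow_const u y (Or.inl (ha.trans_le hu.1).ne')).continuousWithinAt
  have hb := (isCompact_Icc.image_of_continuousOn hc).bddAbove
  rw [Set.image_eq_range] at hb
  exact le_ciSup (f := fun u : Set.Icc a b => (u : ℝ) ^ y) hb ⟨s, hs⟩

/-- The growth bound at scale `s` is controlled by the mean of the activation at that scale. -/
lemma growth_le_scaleRatio_mul (hL : ∀ t, |σ t| ≤ L * |t| ^ p) (ha : 0 < a)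
    (hκ : 0 < gaussianKappa σ q a b) (hs : s ∈ Set.Icc a b) :
    L * s ^ p ≤ scaleRatio σ L p q a b * |gaussianExp (fun x => σ (s * x))| := by
  have hs0 : 0 < s := ha.trans_le hs.1
  have hL0 := growth_const_nonneg hL
  have h1 := rpow_le_iSup_Icc ha hs (p - q)
  have h2 := gaussianKappa_mul_le (σ := σ) (q := q) ha hs
  have h0 : 0 ≤ s ^ (p - q) := by positivity
  have h3 := h0.trans h1
  calc L * s ^ p = L / gaussianKappa σ q a b * s ^ (p - q) * (gaussianKappa σ q a b * s ^ q) := by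
        rw [show s ^ p = s ^ (p - q) * s ^ q by rw [← Real.rpow_add hs0, sub_add_cancel]]
        field_simp
    _ ≤ _ := by
        rw [scaleRatio]
        gcongr

/-- A real supremum bounds its members only when the family is bounded above; here the growth
condition and `κ > 0` bound every ratio by `r²` times an absolute Gaussian moment. -/
lemma gaussianExp_sq_le_gaussianRatio_mul (hσ : Measurable σ) (hL : ∀ t, |σ t| ≤ L * |t| ^ p)
    (hp : 0 < p) (ha : 0 < a) (hκ : 0 < gaussianKappa σ q a b) (hs : s ∈ Set.Icc a b) :
    gaussianExp (fun x => σ (s * x) ^ 2) ≤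
      gaussianRatio σ a b * gaussianExp (fun x => σ (s * x)) ^ 2 := by
  have hL0 := growth_const_nonneg hL
  have hpos : ∀ u ∈ Set.Icc a b, 0 < gaussianExp (fun x => σ (u * x)) ^ 2 := fun u hu =>
    sq_pos_of_ne_zero (gaussianExp_ne_zero ha hκ hu)
  rw [← div_le_iff₀ (hpos s hs)]
  refine le_ciSup (f := fun s : Set.Icc a b => gaussianExp (fun x => σ ((s : ℝ) * x) ^ 2) /
    gaussianExp (fun x => σ ((s : ℝ) * x)) ^ 2)
    ⟨scaleRatio σ L p q a b ^ 2 * gaussianAbsMoment (2 * p), ?_⟩ ⟨s, hs⟩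
  rintro _ ⟨u, rfl⟩
  have hu0 : (0 : ℝ) < u := ha.trans_le u.2.1
  have hM := gaussianAbsMoment_nonneg (2 * p)
  simp only
  rw [div_le_iff₀ (hpos u u.2)]
  calc _ ≤ (L * (u : ℝ) ^ p) ^ 2 * gaussianAbsMoment (2 * p) :=
        gaussianExp_sq_le_moment hσ hL hp hu0
    _ ≤ (scaleRatio σ L p q a b * |gaussianExp (fun x => σ (u * x))|) ^ 2 *
        gaussianAbsMoment (2 * p) :=
        mul_le_mul_of_nonneg_right (pow_le_pow_left₀ (by positivity)
          (growth_le_scaleRatio_mul hL ha hκ u.2) 2) hM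
    _ = _ := by rw [mul_pow, sq_abs]; ring

end Activation

/-! ### Concentration of row statistics. -/

section Rows
variable {Ω : Type*} [MeasurableSpace Ω] {P : Measure Ω} {m d n : ℕ}
  {W : Ω → Matrix (Fin m) (Fin d) ℝ}

/-- Row statistics of the post-activation matrix are independent. -/
lemma IsGaussianWeight.iIndepFun_row_statistic (hW : IsGaussianWeight W P)
    (X : Matrix (Fin d) (Fin n) ℝ) {f : Fin n → ℝ → ℝ} (hf : ∀ t, Measurable (f t)) :
    iIndepFun (fun (i : Fin m) ω => ∑ t, f t ((W ω * X) i t)) P :=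
  hW.iIndepFun_row.comp (fun _ v => ∑ t, f t (∑ j, v j * X j t)) fun _ =>
    Finset.measurable_sum _ fun t _ => (hf t).comp (by fun_prop)

lemma IsGaussianWeight.aemeasurable_row_statistic (hW : IsGaussianWeight W P)
    (X : Matrix (Fin d) (Fin n) ℝ) {f : Fin n → ℝ → ℝ} (hf : ∀ t, Measurable (f t)) (i : Fin m) :
    AEMeasurable (fun ω => ∑ t, f t ((W ω * X) i t)) P := by
  have h : Measurable fun v : Fin d → ℝ => ∑ t, f t (∑ j, v j * X j t) :=
    Finset.measurable_sum _ fun t _ => (hf t).comp (by fun_prop)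
  exact h.comp_aemeasurable (hW.aemeasurable_row i)

end Rows

/-- Concentration of a normalised row statistic of the pre-activations: a common form of the two
tail bounds, for the bilinear form and for the Frobenius norm. -/
theorem exists_row_statistic_tail {p : ℝ} (hp : 1 ≤ p) :
    ∃ c : ℝ, 0 < c ∧ ∀ {Ω : Type*} [MeasurableSpace Ω] (P : Measure Ω) [IsProbabilityMeasure P]
      {m d n : ℕ} {X : Matrix (Fin d) (Fin n) ℝ} {W : Ω → Matrix (Fin m) (Fin d) ℝ}
      {f : Fin n → ℝ → ℝ} {e : Fin n → ℝ} {R ε s : ℝ},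
      (∀ t, X.col t ≠ 0) → IsGaussianWeight W P → (∀ t, Measurable (f t)) →
      (∀ t, 0 ≤ e t) → 0 < ∑ t, e t →
      (∀ t, ∫ x, f t (1 / √(d : ℝ) * colNorm X t * x) ∂(gaussianReal 0 1) = e t) →
      (∀ t x, |f t (1 / √(d : ℝ) * colNorm X t * x)| ≤ R * e t * |x| ^ p) →
      0 < ε → ε ≤ 1 → |s| = 1 →
      P.real {ω | m * ε ≤ ∑ i, s * ((∑ t, f t ((W ω * X) i t)) / ∑ t, e t - 1)} ≤
        2 * Real.exp (-(c * min ((m : ℝ) * ε ^ 2 * R ^ (-2 : ℤ))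
          ((m : ℝ) ^ (min 1 (2 / p)) * ε ^ (2 / p) * R ^ (-(2 / p))))) := by
  have hp0 : 0 < p := by linarith
  obtain ⟨c, hc, h⟩ := exists_tail_of_abs_le_weighted_abs_rpow hp
  refine ⟨c, hc, ?_⟩
  intro Ω _ P _ m d n X W f e R ε s hX hW hf he hE hint hle hε hε1 hs
  set E := ∑ t, e t with hEdef
  set g : Fin m → Fin n → Ω → ℝ := fun i t ω => (W ω * X) i t / (1 / √(d : ℝ) * colNorm X t)
    with hg
  have hglaw : ∀ i t, HasLaw (g i t) (gaussianReal 0 1) P := fun i t => hW.hasLaw_div (hX t) i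
  have hfg : ∀ i t ω, f t ((W ω * X) i t) = f t (1 / √(d : ℝ) * colNorm X t * g i t ω) := by
    intro i t ω
    rw [hg]
    simp only
    rw [mul_div_cancel₀ _ (scale_pos (hX t)).ne']
  have hfint : ∀ t, Integrable (fun x => f t (1 / √(d : ℝ) * colNorm X t * x))
      (gaussianReal 0 1) := fun t =>
    ((integrable_abs_rpow_gaussianReal hp0).const_mul (R * e t)).mono'
      ((hf t).comp (measurable_const_mul _)).aestronglyMeasurable
      (.of_forall fun x => hle t x)
  -- With weights `e t / E`, the columnwise bounds `R * e t * |x| ^ p` add up to `R` times a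
  -- weighted average.
  refine h P (w := fun t => e t / E) (g := g)
    (Y := fun i ω => (∑ t, f t ((W ω * X) i t)) / E) (fun t => div_nonneg (he t) hE.le) ?_ hglaw
    ?_ ?_ ?_ ?_ hε hε1 hs
  · rw [← Finset.sum_div, div_self hE.ne']
  · exact (hW.iIndepFun_row_statistic X hf).comp (fun _ x => x / E) fun _ => by fun_prop
  · exact fun i => (hW.aemeasurable_row_statistic X hf i).div_const E
  · intro i
    simp only [hfg]
    rw [integral_div, integral_finsetSum _ fun t _ =>
      HasLaw.integrable_comp (hglaw i t) (hfint t)]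
    have h1 : ∀ t, ∫ ω, f t (1 / √(d : ℝ) * colNorm X t * g i t ω) ∂P = e t := fun t => by
      rw [← hint t]
      exact (hglaw i t).integral_comp (f := fun x => f t (1 / √(d : ℝ) * colNorm X t * x))
        (hfint t).aestronglyMeasurable
    simp_rw [h1]
    exact div_self hE.ne'
  · intro i ω
    simp only [hfg]
    rw [abs_div, abs_of_pos hE, Finset.mul_sum, div_le_iff₀ hE, Finset.sum_mul]
    refine (Finset.abs_sum_le_sum_abs _ _).trans (Finset.sum_le_sum fun t _ => ?_)
    refine (hle t _).trans (le_of_eq ?_)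
    field_simp

/-! ### The ReLU ratio. -/

/-- A Gamma integral over the positive half-line; `k ≠ 0` is needed for the integrand to vanish on
the other half. -/
lemma integral_relu_pow_gaussianReal {k : ℕ} (hk : k ≠ 0) :
    ∫ x, relu x ^ k ∂(gaussianReal 0 1) =
      (√(2 * Real.pi))⁻¹ * ((1 / 2) ^ (-((k : ℝ) + 1) / 2) * (1 / 2) *
        Real.Gamma (((k : ℝ) + 1) / 2)) := by
  rw [integral_gaussianReal_eq_integral_smul one_ne_zero,
    ← integral_rpow_mul_exp_neg_mul_rpow (p := 2) (q := k) (b := 1 / 2) (by norm_num)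
      (by linarith [(Nat.cast_nonneg k : (0 : ℝ) ≤ k)]) (by norm_num),
    ← integral_const_mul, ← integral_indicator measurableSet_Ioi]
  congr 1
  ext x
  by_cases hx : 0 < x
  · rw [Set.indicator_of_mem (Set.mem_Ioi.mpr hx)]
    simp only [gaussianPDFReal, relu, max_eq_left hx.le, smul_eq_mul, Real.rpow_natCast,
      Real.rpow_two, NNReal.coe_one, mul_one, sub_zero]
    ring_nf
  · rw [Set.indicator_of_notMem (by simpa using hx)]
    simp [relu, max_eq_right (not_lt.mp hx), hk]

lemma integral_relu_gaussianReal : ∫ x, relu x ∂(gaussianReal 0 1) = (√(2 * Real.pi))⁻¹ := by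
  have h := integral_relu_pow_gaussianReal one_ne_zero
  simp only [pow_one, Nat.cast_one] at h
  rw [h]
  norm_num [Real.rpow_neg_one]

lemma integral_relu_sq_gaussianReal : ∫ x, relu x ^ 2 ∂(gaussianReal 0 1) = 1 / 2 := by
  rw [integral_relu_pow_gaussianReal two_ne_zero]
  have hG : Real.Gamma (((2 : ℕ) + 1 : ℝ) / 2) = 1 / 2 * √Real.pi := by
    rw [show (((2 : ℕ) + 1 : ℝ) / 2) = 1 / 2 + 1 by norm_num, Real.Gamma_add_one (by norm_num),
      Real.Gamma_one_half_eq]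
  have hpow : ((1 : ℝ) / 2) ^ (-(((2 : ℕ) : ℝ) + 1) / 2) = 2 * √2 := by
    rw [show (-(((2 : ℕ) : ℝ) + 1) / 2) = -(1 + 1 / 2) by norm_num, one_div (2 : ℝ),
      Real.inv_rpow (by norm_num), ← Real.rpow_neg (by norm_num), neg_neg, Real.rpow_add (by norm_num), Real.rpow_one,
      Real.sqrt_eq_rpow, one_div]
  rw [hG, hpow, Real.sqrt_mul (by norm_num)]
  have : 0 < √Real.pi := Real.sqrt_pos.mpr Real.pi_pos
  field_simp

theorem gaussianRatio_relu {a b : ℝ} (ha : 0 < a) (hab : a ≤ b) :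
    gaussianRatio relu a b = Real.pi := by
  have : Nonempty (Set.Icc a b) := ⟨⟨a, le_rfl, hab⟩⟩
  have h : ∀ s : Set.Icc a b, gaussianExp (fun x => relu ((s : ℝ) * x) ^ 2) /
      gaussianExp (fun x => relu ((s : ℝ) * x)) ^ 2 = Real.pi := by
    intro s
    have hs : (0 : ℝ) < s := ha.trans_le s.2.1
    have hrelu : ∀ x, relu ((s : ℝ) * x) = s * relu x := fun x => by
      rw [relu, relu, mul_max_of_nonneg _ _ hs.le, mul_zero]
    simp only [gaussianExp, hrelu, mul_pow]
    rw [integral_const_mul, integral_const_mul, integral_relu_gaussianReal,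
      integral_relu_sq_gaussianReal, mul_pow, inv_pow,
      Real.sq_sqrt (by positivity)]
    field_simp
  simp only [gaussianRatio, h, ciSup_const]

/-! ### Assembly of the two tail bounds. -/

theorem mainTheorem1 :
    (∀ p : ℝ, 1 ≤ p → ∃ c : ℝ, 0 < c ∧
      ∀ (m d n : ℕ) (_ : 0 < n) (X : Matrix (Fin d) (Fin n) ℝ) (_ : ∀ t, X.col t ≠ 0)
        (Ω : Type*) [MeasurableSpace Ω] (P : Measure Ω) [IsProbabilityMeasure P]
        (W : Ω → Matrix (Fin m) (Fin d) ℝ) (_ : IsGaussianWeight W P)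
        (σ : ℝ → ℝ) (_ : Measurable σ) (_ : σ 0 = 0)
        (L : ℝ) (_ : ∀ t, |σ t| ≤ L * |t| ^ p)
        (a b : ℝ) (_ : a = minScale X) (_ : b = maxScale X)
        (q : ℝ) (_ : 0 < q) (_ : 0 < gaussianKappa σ q a b)
        (r : ℝ) (_ : r = scaleRatio σ L p q a b)
        (ε₁ ε₂ : ℝ) (_ : 0 < ε₁) (_ : ε₁ ≤ 1) (_ : 0 < ε₂) (_ : ε₂ < 1),
        1 - 2 * Real.exp (-(c * min ((m : ℝ) * ε₂ ^ 2 * r ^ (-2 : ℤ))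
                ((m : ℝ) ^ (min 1 (2 / p)) * ε₂ ^ (2 / p) * r ^ (-(2 / p)))))
          - 2 * Real.exp (-(c * min ((m : ℝ) * ε₁ ^ 2 * r ^ (-4 : ℤ))
                ((m : ℝ) ^ (min 1 (1 / p)) * ε₁ ^ (1 / p) * r ^ (-(2 / p)))))
          ≤ P.real {ω | postActivation σ (W ω) X ≠ 0 ∧
              stableRank (postActivation σ (W ω) X)
                ≤ (1 + ε₁) / (1 - ε₂) ^ 2 * gaussianRatio σ a b}) ∧
    (∀ a b : ℝ, 0 < a → a ≤ b → gaussianRatio relu a b = Real.pi) := by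
  refine ⟨fun p hp => ?_, fun a b ha hab => gaussianRatio_relu ha hab⟩
  have hp0 : 0 < p := by linarith
  obtain ⟨c₂, hc₂, htail₂⟩ := exists_row_statistic_tail hp
  -- The Frobenius norm involves `σ²`, which has growth exponent `2 * p`.
  obtain ⟨c₁, hc₁, htail₁⟩ := exists_row_statistic_tail (p := 2 * p) (by linarith)
  refine ⟨min c₁ c₂, by positivity, ?_⟩
  intro m d n hn X hX Ω _ P _ W hW σ hσ _ L hL a b ha hb q _ hκ r hr ε₁ ε₂ hε₁ hε₁1 hε₂ hε₂1
  have ha0 : 0 < a := ha ▸ minScale_pos hn hX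
  set s : Fin n → ℝ := fun t => 1 / √(d : ℝ) * colNorm X t with hs
  have hsI : ∀ t, s t ∈ Set.Icc a b := fun t => by rw [ha, hb]; exact scale_mem_Icc X t
  have hs0 : ∀ t, 0 < s t := fun t => scale_pos (hX t)
  set μ : Fin n → ℝ := fun t => gaussianExp (fun x => σ (s t * x)) with hμ
  set e : Fin n → ℝ := fun t => gaussianExp (fun x => σ (s t * x) ^ 2) with he
  have hL0 := growth_const_nonneg hL
  have hr0 : 0 ≤ r := by
    have h1 := rpow_le_iSup_Icc ha0 (hsI ⟨0, hn⟩) (p - q)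
    have h2 : 0 ≤ s ⟨0, hn⟩ ^ (p - q) := Real.rpow_nonneg (hs0 _).le _
    rw [hr, scaleRatio]
    exact mul_nonneg (div_nonneg hL0 hκ.le) (h2.trans h1)
  have hgrow : ∀ t, L * s t ^ p ≤ r * |μ t| := fun t => by
    rw [hr]; exact growth_le_scaleRatio_mul hL ha0 hκ (hsI t)
  have hμ0 : ∀ t, 0 < μ t ^ 2 := fun t => sq_pos_of_ne_zero (gaussianExp_ne_zero ha0 hκ (hsI t))
  have hμe : ∀ t, μ t ^ 2 ≤ e t := fun t => gaussianExp_sq_le hσ hL hp0 (hs0 t)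
  have hne : (Finset.univ : Finset (Fin n)).Nonempty := ⟨⟨0, hn⟩, Finset.mem_univ _⟩
  have hS : 0 < ∑ t, μ t ^ 2 := Finset.sum_pos (fun t _ => hμ0 t) hne
  have hE : 0 < ∑ t, e t := Finset.sum_pos (fun t _ => (hμ0 t).trans_le (hμe t)) hne
  -- Lower tail (`s = -1`) of the bilinear form with test vector `μ`.
  have hb₂ := htail₂ P (f := fun t y => μ t * σ y) (e := fun t => μ t ^ 2) (R := r) (ε := ε₂)
    (s := -1) hX hW (fun t => hσ.const_mul _) (fun t => sq_nonneg _) hS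
    (fun t => by rw [integral_const_mul, sq]; rfl)
    (fun t x => by
      have h1 := abs_activation_le hL (hs0 t) x
      calc |μ t * σ (s t * x)| = |μ t| * |σ (s t * x)| := abs_mul _ _
        _ ≤ |μ t| * (r * |μ t| * |x| ^ p) := by
            gcongr
            exact h1.trans (mul_le_mul_of_nonneg_right (hgrow t) (by positivity))
        _ = r * μ t ^ 2 * |x| ^ p := by rw [← sq_abs (μ t)]; ring)
    hε₂ hε₂1.le (by norm_num)
  -- Upper tail (`s = 1`) of the squared Frobenius norm.
  have hb₁ := htail₁ P (f := fun _ y => σ y ^ 2) (e := e) (R := r ^ 2) (ε := ε₁)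
    (s := 1) hX hW (fun t => hσ.pow_const 2) (fun t => (hμ0 t).le.trans (hμe t)) hE
    (fun t => rfl)
    (fun t x => by
      rw [abs_of_nonneg (sq_nonneg _)]
      refine (sq_activation_le hL (hs0 t) x).trans ?_
      gcongr
      calc (L * s t ^ p) ^ 2 ≤ (r * |μ t|) ^ 2 :=
            pow_le_pow_left₀ (mul_nonneg hL0 (Real.rpow_nonneg (hs0 t).le _)) (hgrow t) 2
        _ = r ^ 2 * μ t ^ 2 := by rw [mul_pow, sq_abs]
        _ ≤ r ^ 2 * e t := by gcongr; exact hμe t)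
    hε₁ hε₁1 (by norm_num)
  have hexp1 : 2 / (2 * p) = 1 / p := by field_simp
  have hexp2 : (r ^ 2) ^ (-2 : ℤ) = r ^ (-4 : ℤ) := by
    rw [← zpow_natCast, ← zpow_mul]; norm_num
  have hexp3 : (r ^ 2) ^ (-(1 / p)) = r ^ (-(2 / p)) := by
    rw [← Real.rpow_two, ← Real.rpow_mul hr0]
    congr 1
    ring
  rw [hexp1, hexp2, hexp3] at hb₁
  have hU₂ : 0 ≤ min ((m : ℝ) * ε₂ ^ 2 * r ^ (-2 : ℤ))
      ((m : ℝ) ^ (min 1 (2 / p)) * ε₂ ^ (2 / p) * r ^ (-(2 / p))) := by positivity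
  have hU₁ : 0 ≤ min ((m : ℝ) * ε₁ ^ 2 * r ^ (-4 : ℤ))
      ((m : ℝ) ^ (min 1 (1 / p)) * ε₁ ^ (1 / p) * r ^ (-(2 / p))) := by positivity
  set U₂ := min ((m : ℝ) * ε₂ ^ 2 * r ^ (-2 : ℤ))
      ((m : ℝ) ^ (min 1 (2 / p)) * ε₂ ^ (2 / p) * r ^ (-(2 / p)))
  set U₁ := min ((m : ℝ) * ε₁ ^ 2 * r ^ (-4 : ℤ))
      ((m : ℝ) ^ (min 1 (1 / p)) * ε₁ ^ (1 / p) * r ^ (-(2 / p)))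
  have hx₂ : Real.exp (-(c₂ * U₂)) ≤ Real.exp (-(min c₁ c₂ * U₂)) :=
    Real.exp_le_exp.mpr (neg_le_neg (mul_le_mul_of_nonneg_right (min_le_right _ _) hU₂))
  have hx₁ : Real.exp (-(c₁ * U₁)) ≤ Real.exp (-(min c₁ c₂ * U₁)) :=
    Real.exp_le_exp.mpr (neg_le_neg (mul_le_mul_of_nonneg_right (min_le_left _ _) hU₁))
  set B₂ := {ω | (m : ℝ) * ε₂ ≤
    ∑ i, -1 * ((∑ t, μ t * σ ((W ω * X) i t)) / ∑ t, μ t ^ 2 - 1)} with hB₂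
  set B₁ := {ω | (m : ℝ) * ε₁ ≤
    ∑ i, 1 * ((∑ t, σ ((W ω * X) i t) ^ 2) / ∑ t, e t - 1)} with hB₁
  set G := {ω | postActivation σ (W ω) X ≠ 0 ∧
              stableRank (postActivation σ (W ω) X)
                ≤ (1 + ε₁) / (1 - ε₂) ^ 2 * gaussianRatio σ a b} with hG
  -- Mediant inequality: the bound holds for each column, hence for the sums.
  have hratio : (∑ t, e t) / ∑ t, μ t ^ 2 ≤ gaussianRatio σ a b := by
    rw [div_le_iff₀ hS, Finset.mul_sum]
    exact Finset.sum_le_sum fun t _ =>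
      gaussianExp_sq_le_gaussianRatio_mul hσ hL hp0 ha0 hκ (hsI t)
  have hcover : (Set.univ : Set Ω) ⊆ G ∪ (B₂ ∪ B₁) := by
    intro ω _
    by_cases h₂ : ω ∈ B₂
    · exact Or.inr (Or.inl h₂)
    by_cases h₁ : ω ∈ B₁
    · exact Or.inr (Or.inr h₁)
    left
    simp only [hB₂, Set.mem_ofPred_eq, not_le, ← Finset.mul_sum, Finset.sum_sub_distrib,
      Finset.sum_const, Finset.card_univ, Fintype.card_fin, nsmul_eq_mul, mul_one,
      ← Finset.sum_div] at h₂
    simp only [hB₁, Set.mem_ofPred_eq, not_le, ← Finset.mul_sum, Finset.sum_sub_distrib,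
      Finset.sum_const, Finset.card_univ, Fintype.card_fin, nsmul_eq_mul, mul_one,
      ← Finset.sum_div] at h₁
    -- For `m = 0` the condition defining `B₂` reads `0 ≤ 0`, so `ω` would lie in `B₂`.
    have hm : 0 < m := by
      rcases Nat.eq_zero_or_pos m with rfl | h
      · simp at h₂
      · exact h
    obtain ⟨hA, hst⟩ := stableRank_le_of_bounds (A := postActivation σ (W ω) X) (v := μ)
      (E := ∑ t, e t) (δ := 1 - ε₂) (η := 1 + ε₁) hm hS (by linarith)
      (by
        rw [← le_div_iff₀ hS]
        simp only [postActivation, Matrix.map_apply]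
        linarith)
      (by
        rw [← div_le_iff₀ hE]
        simp only [postActivation, Matrix.map_apply]
        linarith)
    exact ⟨hA, hst.trans (mul_le_mul_of_nonneg_left hratio (by positivity))⟩
  have h1 : (1 : ℝ) ≤ P.real G + (P.real B₂ + P.real B₁) := by
    calc (1 : ℝ) = P.real Set.univ := probReal_univ.symm
      _ ≤ P.real (G ∪ (B₂ ∪ B₁)) := measureReal_mono hcover
      _ ≤ P.real G + P.real (B₂ ∪ B₁) := measureReal_union_le _ _
      _ ≤ _ := by gcongr; exact measureReal_union_le _ _
  linarith
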